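/- Let $p$ be a prime, let $n\ge 1$, and put $m=p^n$. Let $\mathcal T$ be the $m$-adic rooted tree, whose vertices are the words over an alphabet $\{x_1,\dots,x_m\}$, two words being joined by an edge when one is obtained from the other by appending a letter. Let $\mathcal G=\langle a,b\rangle\le \operatorname{Aut}\mathcal T$ be the GGS-group with constant defining vector $(1,\dots,1)$: here $a$ is the rooted automorphism permuting the first letter of each word by the $m$-cycle $(x_1,x_2,\dots,x_m)$, and $b$ is defined recursively by $b(x_iz)=x_i\,a(z)$ for $1\le i\le m-1$ and $b(x_mz)=x_m\,b(z)$ for all words $z$. Let $K=\langle ba^{-1}\rangle^{\mathcal G}$ be the normal closure of $ba^{-1}$ in $\mathcal G$, and let $K'=[K,K]$. Then $\mathcal G/K'$ is isomorphic to the semidirect product $\langle x\rangle\ltimes\mathbb Z^{p^n-1}$, where $x$ has order $p^n$ and acts on $\mathbb Z^{p^n-1}$ through the companion matrix of the polynomial $X^{p^n-1}+X^{p^n-2}+\cdots+X+1$. That is, $x$ sends the canonical basis vector $v_i$ to $v_{i+1}$ for $1\le i<p^n-1$, and $v_{p^n-1}$ to $-(v_1+\cdots+v_{p^n-1})$. In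 particular, $\mathcal G/K'$ is infinite. -/

import Mathlib

namespace GGS

/-- The `m`-adic rooted tree. Its vertices are the words over the alphabet `Fin m`
(the letters `0, …, m - 1` stand for `x₁, …, x_m`), the root is the empty word, and two words are
adjacent when one of them is obtained from the other by appending one letter. -/
def tree (m : ℕ) : SimpleGraph (List (Fin m)) where
  Adj u v := (∃ x, v = u ++ [x]) ∨ (∃ x, u = v ++ [x])
  symm := ⟨fun _ _ h => h.symm⟩
  loopless := ⟨fun u h => by rcases h with ⟨x, hx⟩ | ⟨x, hx⟩ <;> simp at hx⟩

/-- `Aut 𝒯`, the group of graph automorphisms of the `m`-adic tree under composition. -/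
abbrev TreeAut (m : ℕ) : Type := tree m ≃g tree m

/-- Two mutually inverse self-maps of the set of words that send immediate descendants to
immediate descendants give an automorphism of the tree. -/
def autOfMaps {m : ℕ} (f g : List (Fin m) → List (Fin m))
    (hgf : ∀ u, g (f u) = u) (hfg : ∀ u, f (g u) = u)
    (hf : ∀ u x, ∃ y, f (u ++ [x]) = f u ++ [y])
    (hg : ∀ u x, ∃ y, g (u ++ [x]) = g u ++ [y]) : TreeAut m where
  toFun := f
  invFun := g
  left_inv := hgf
  right_inv := hfg
  map_rel_iff' := by
    have key : ∀ (k : List (Fin m) → List (Fin m)),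
        (∀ u x, ∃ y, k (u ++ [x]) = k u ++ [y]) →
        ∀ u v, (tree m).Adj u v → (tree m).Adj (k u) (k v) := by
      rintro k hk u v (⟨x, rfl⟩ | ⟨x, rfl⟩)
      · exact Or.inl (hk u x)
      · exact Or.inr (hk v x)
    intro u v
    refine ⟨fun h => ?_, fun h => key f hf u v h⟩
    have h' := key g hg _ _ h
    simpa [hgf] using h'

/-- `x z ↦ ρ(x) z` on words. -/
def rootedFun {m : ℕ} (ρ : Equiv.Perm (Fin m)) : List (Fin m) → List (Fin m)
  | [] => []
  | x :: z => ρ x :: z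

/-- The rooted automorphism corresponding to a permutation `ρ` of the alphabet:
it sends the word `x z` to `ρ(x) z`. -/
def rooted {m : ℕ} (ρ : Equiv.Perm (Fin m)) : TreeAut m :=
  autOfMaps (rootedFun ρ) (rootedFun ρ⁻¹)
    (by rintro (_ | ⟨x, z⟩) <;> simp [rootedFun])
    (by rintro (_ | ⟨x, z⟩) <;> simp [rootedFun])
    (by rintro (_ | ⟨x, z⟩) y <;> simp [rootedFun])
    (by rintro (_ | ⟨x, z⟩) y <;> simp [rootedFun])

theorem rooted_nil {m : ℕ} (ρ : Equiv.Perm (Fin m)) : rooted ρ [] = [] := rfl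

theorem rooted_cons {m : ℕ} (ρ : Equiv.Perm (Fin m)) (x : Fin m) (z : List (Fin m)) :
    rooted ρ (x :: z) = ρ x :: z := rfl

theorem rooted_pow {m : ℕ} (ρ : Equiv.Perm (Fin m)) (k : ℕ) : rooted ρ ^ k = rooted (ρ ^ k) := by
  induction k with
  | zero => ext1 u; rcases u with _ | ⟨x, z⟩ <;> rfl
  | succ k ih =>
    rw [pow_succ, ih, pow_succ]
    ext1 u
    rcases u with _ | ⟨x, z⟩ <;> rfl

/-- The map on words fixing every first letter, acting below the letter number `i < m - 1` as the
rooted automorphism of `ρ i`, and acting below the last letter as the map itself. -/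
def directedFun {m : ℕ} (ρ : Fin (m - 1) → Equiv.Perm (Fin m)) : List (Fin m) → List (Fin m)
  | [] => []
  | x :: z =>
    if h : x.val < m - 1 then x :: rooted (ρ ⟨x.val, h⟩) z else x :: directedFun ρ z

theorem directedFun_inv {m : ℕ} (ρ ρ' : Fin (m - 1) → Equiv.Perm (Fin m))
    (h : ∀ i, ρ' i * ρ i = 1) (u : List (Fin m)) : directedFun ρ' (directedFun ρ u) = u := by
  induction u with
  | nil => rfl
  | cons x z ih =>
    by_cases hx : x.val < m - 1
    · have h1 : ∀ y, ρ' ⟨x.val, hx⟩ (ρ ⟨x.val, hx⟩ y) = y := fun y =>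
        DFunLike.congr_fun (h ⟨x.val, hx⟩) y
      rcases z with _ | ⟨y, z⟩ <;> simp [directedFun, hx, rooted_nil, rooted_cons, h1]
    · simp [directedFun, hx, ih]

theorem directedFun_append {m : ℕ} (ρ : Fin (m - 1) → Equiv.Perm (Fin m)) (u : List (Fin m))
    (y : Fin m) : ∃ y', directedFun ρ (u ++ [y]) = directedFun ρ u ++ [y'] := by
  induction u with
  | nil =>
    refine ⟨y, ?_⟩
    by_cases hy : y.val < m - 1 <;> simp [directedFun, hy, rooted_nil]
  | cons x z ih =>
    by_cases hx : x.val < m - 1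
    · rcases z with _ | ⟨w, z⟩ <;> simp [directedFun, hx, rooted_nil, rooted_cons]
    · obtain ⟨y', hy'⟩ := ih
      exact ⟨y', by simp [directedFun, hx, hy']⟩

/-- The automorphism with underlying map `directedFun ρ`. -/
def directed {m : ℕ} (ρ : Fin (m - 1) → Equiv.Perm (Fin m)) : TreeAut m :=
  autOfMaps (directedFun ρ) (directedFun fun i => (ρ i)⁻¹)
    (directedFun_inv _ _ fun _ => inv_mul_cancel _)
    (directedFun_inv _ _ fun _ => mul_inv_cancel _)
    (directedFun_append _) (directedFun_append _)

/-- The generator `a`: the rooted automorphism of the `m`-cycle `(x₁, x₂, …, x_m)`. -/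
def genA (m : ℕ) : TreeAut m := rooted (finRotate m)

/-- The generator `b` for the defining vector `e`: it fixes the first level and
`ψ(b) = (a^{e₁}, …, a^{e_{m-1}}, b)`, see `genB_cons_of_lt` and `genB_cons_last`. -/
def genB {m : ℕ} (e : Fin (m - 1) → ZMod m) : TreeAut m :=
  directed fun i => finRotate m ^ (e i).val

theorem genB_nil {m : ℕ} (e : Fin (m - 1) → ZMod m) : genB e [] = [] := rfl

/-- The section of `b` at the letter number `i < m - 1` is `a ^ (e i)`. -/
theorem genB_cons_of_lt {m : ℕ} (e : Fin (m - 1) → ZMod m) (x : Fin m) (hx : x.val < m - 1)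
    (z : List (Fin m)) : genB e (x :: z) = x :: (genA m ^ (e ⟨x.val, hx⟩).val) z := by
  rw [genA, rooted_pow]
  exact dif_pos hx

/-- The section of `b` at the last letter is `b`. -/
theorem genB_cons_last {m : ℕ} (e : Fin (m - 1) → ZMod m) (x : Fin m) (hx : ¬ x.val < m - 1)
    (z : List (Fin m)) : genB e (x :: z) = x :: genB e z :=
  dif_neg hx

/-- The GGS-group `⟨a, b⟩ ≤ Aut 𝒯` with defining vector `e`. -/
def ggsGroup {m : ℕ} (e : Fin (m - 1) → ZMod m) : Subgroup (TreeAut m) :=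
  Subgroup.closure {genA m, genB e}

/-- `a` as an element of the GGS-group. -/
def ggsA {m : ℕ} (e : Fin (m - 1) → ZMod m) : ggsGroup e :=
  ⟨genA m, Subgroup.subset_closure (by simp)⟩

/-- `b` as an element of the GGS-group. -/
def ggsB {m : ℕ} (e : Fin (m - 1) → ZMod m) : ggsGroup e :=
  ⟨genB e, Subgroup.subset_closure (by simp)⟩

/-- The GGS-group with constant defining vector `(1, …, 1)` over the `m`-adic tree. -/
abbrev constGroup (m : ℕ) : Type := ggsGroup (fun _ : Fin (m - 1) => (1 : ZMod m))

/-- The normal closure `K` of `b a⁻¹` in the GGS-group with constant defining vector. -/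
def subgroupK (m : ℕ) : Subgroup (constGroup m) :=
  Subgroup.normalClosure {ggsB (fun _ => 1) * (ggsA (fun _ => 1))⁻¹}

instance subgroupK_normal (m : ℕ) : (subgroupK m).Normal := Subgroup.normalClosure_normal

/-- The companion matrix, of size `d`, of a monic polynomial `f` of degree `d`, for the action on
row vectors: it sends the basis vector `v_i` to `v_{i+1}`, and the last basis vector to
`- ∑ j, f_j v_j`, where `f_j` is the coefficient of `X ^ j` in `f`. -/
def companion (d : ℕ) (f : Polynomial ℤ) : Matrix (Fin d) (Fin d) ℤ :=
  Matrix.of fun i j =>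
    if i.val + 1 = d then - f.coeff j.val else if j.val = i.val + 1 then 1 else 0

end GGS

namespace GGS

/-! Put m = p^n, let T be the companion matrix and e the first basis vector, so that T^m = 1 and e +
Te + ⋯ + T^(m-1)e = 0. The isomorphism is induced by a ↦ (0, x), b ↦ (e, x); on words its lattice
part is the crossed homomorphism `wordCocycle`.

Well-definedness (`dvd_length_and_wordCocycle_eq_zero`) uses self-similarity: the cocycle of a word
is a sum of T-translates of the cocycles of its sections (`wordCocycle_eq_sum`), and the sections
share out the letters b of the word. Induction on the number of b's therefore only stalls when one
section has them all; then that section is a power of b and the others are powers of a.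

For the kernel (`ker_eq_commutator`), a word w equals k·a^|w| with k in K, and the class of k in
K/K' is the same cocycle, formed with conjugation by a and the class of ba⁻¹. Since b^m = a^m = 1,
that class satisfies the relation defining the lattice, so the lattice maps onto the cocycle values
in K/K'; a word with trivial image thus has k in K'. -/

/-! ### Positive words in two generators -/

/-- The value of a word in two elements `a` (the letter `false`) and `b` (the letter `true`). -/
def wordEval {G : Type*} [Monoid G] (a b : G) (w : List Bool) : G :=
  (w.map fun s => cond s b a).prod

section wordEval

variable {G : Type*} [Monoid G] (a b : G)

@[simp] theorem wordEval_nil : wordEval a b [] = 1 := rfl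

@[simp] theorem wordEval_cons (s : Bool) (w : List Bool) :
    wordEval a b (s :: w) = cond s b a * wordEval a b w := by simp [wordEval]

theorem wordEval_append (w w' : List Bool) :
    wordEval a b (w ++ w') = wordEval a b w * wordEval a b w' := by simp [wordEval]

theorem wordEval_replicate (k : ℕ) (s : Bool) :
    wordEval a b (List.replicate k s) = (cond s b a) ^ k := by simp [wordEval]

theorem map_wordEval {H : Type*} [Monoid H] (f : G →* H) (w : List Bool) :
    f (wordEval a b w) = wordEval (f a) (f b) w := by
  induction w with
  | nil => simp
  | cons s w ih => cases s <;> simp [ih]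

end wordEval

/-- Inverses are (m-1)-th powers, so positive words suffice. -/
theorem exists_wordEval_of_mem_closure {G : Type*} [Group G] {a b : G} {m : ℕ} (hm : 1 ≤ m)
    (ha : a ^ m = 1) (hb : b ^ m = 1) {g : G} (hg : g ∈ Subgroup.closure {a, b}) :
    ∃ w, wordEval a b w = g := by
  have inv_eq : ∀ c : G, c ^ m = 1 → c⁻¹ = c ^ (m - 1) := fun c hc => by
    rw [inv_eq_iff_mul_eq_one, ← pow_succ', Nat.sub_add_cancel hm, hc]
  induction hg using Subgroup.closure_induction_left with
  | one => exact ⟨[], rfl⟩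
  | mul_left x hx y _ ih =>
    obtain ⟨w, rfl⟩ := ih
    rcases hx with rfl | rfl
    · exact ⟨false :: w, by simp⟩
    · exact ⟨true :: w, by simp⟩
  | inv_mul_cancel x hx y _ ih =>
    obtain ⟨w, rfl⟩ := ih
    rcases hx with rfl | rfl
    · exact ⟨List.replicate (m - 1) false ++ w, by
        simp [wordEval_append, wordEval_replicate, inv_eq _ ha]⟩
    · exact ⟨List.replicate (m - 1) true ++ w, by
        simp [wordEval_append, wordEval_replicate, inv_eq _ hb]⟩

/-- A map determined on words factors through a group in which the words are evaluated, as soon as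
words with trivial value have trivial image. -/
theorem exists_hom_of_wordEval {G H : Type*} [Group G] [Group H] {a b : G} {x y : H}
    (hsurj : ∀ g : G, ∃ w, wordEval a b w = g)
    (h : ∀ w, wordEval a b w = 1 → wordEval x y w = 1) :
    ∃ f : G →* H, ∀ w, f (wordEval a b w) = wordEval x y w := by
  have key : ∀ w w', wordEval a b w = wordEval a b w' → wordEval x y w = wordEval x y w' := by
    intro w w' hw
    -- A word for the inverse turns equality of two values into triviality of two words with the
    -- same tail.
    obtain ⟨u, hu⟩ := hsurj (wordEval a b w')⁻¹
    have h1 := h (w ++ u) (by rw [wordEval_append, hu, hw, mul_inv_cancel])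
    have h2 := h (w' ++ u) (by rw [wordEval_append, hu, mul_inv_cancel])
    rw [wordEval_append] at h1 h2
    exact mul_right_cancel (h1.trans h2.symm)
  choose r hr using hsurj
  refine ⟨MonoidHom.mk' (fun g => wordEval x y (r g)) fun g g' => ?_, fun w => key _ _ (hr _)⟩
  rw [← wordEval_append]
  exact key _ _ (by rw [wordEval_append, hr, hr, hr])

/-! ### The m-cycle, and sections of words -/

variable {m : ℕ}

theorem finRotate_val (i : Fin m) :
    (finRotate m i).val = if i.val + 1 = m then 0 else i.val + 1 := by
  obtain _ | m := m
  · exact i.elim0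
  · rw [coe_finRotate]
    simp [Fin.ext_iff]

theorem finRotate_pow_val (k : ℕ) (i : Fin m) :
    ((finRotate m ^ k) i).val = (i.val + k) % m := by
  induction k with
  | zero => simp [Nat.mod_eq_of_lt i.isLt]
  | succ k ih =>
    rw [pow_succ', Equiv.Perm.mul_apply, finRotate_val, ih, ← add_assoc]
    have := Nat.mod_lt (i.val + k) i.pos
    split_ifs with h
    · rw [Nat.add_mod (i.val + k)]
      rcases Nat.lt_or_ge 1 m with h1 | h1
      · rw [Nat.mod_eq_of_lt h1, h, Nat.mod_self]
      · obtain rfl : m = 1 := by omega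
        simp [Nat.mod_one]
    · have h1 : 1 % m = 1 := Nat.mod_eq_of_lt (by omega)
      rw [Nat.add_mod (i.val + k), h1, Nat.mod_eq_of_lt (by omega : (i.val + k) % m + 1 < m)]

theorem finRotate_pow_self : finRotate m ^ m = 1 := by
  ext i
  rw [finRotate_pow_val]
  simp [Nat.mod_eq_of_lt i.isLt]

theorem dvd_of_finRotate_pow_eq (k : ℕ) (i : Fin m) (h : (finRotate m ^ k) i = i) : m ∣ k := by
  have h1 := finRotate_pow_val k i
  rw [h] at h1
  have : i.val + k ≡ i.val + 0 [MOD m] := by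
    rw [Nat.ModEq, ← h1, add_zero, Nat.mod_eq_of_lt i.isLt]
  exact (Nat.modEq_zero_iff_dvd).1 (Nat.ModEq.add_left_cancel' _ this)

/-- The permutation of the first letters induced by a word in `a` and `b`. -/
def letterPerm (m : ℕ) (w : List Bool) : Equiv.Perm (Fin m) := finRotate m ^ w.count false

/-- The section at the letter `i` of a word in `a` and `b`, as a word in `a` and `b`. -/
def wordSection (i : Fin m) : List Bool → List Bool
  | [] => []
  | false :: w => wordSection i w
  -- The prefixed b acts after `w`, so it contributes b exactly when `w` moves `i` to the last
  -- letter, and a otherwise.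
  | true :: w => decide ((letterPerm m w i).val + 1 = m) :: wordSection i w

theorem letterPerm_cons_false (w : List Bool) :
    letterPerm m (false :: w) = finRotate m * letterPerm m w := by
  simp [letterPerm, pow_succ']

theorem letterPerm_cons_true (w : List Bool) : letterPerm m (true :: w) = letterPerm m w := by
  simp [letterPerm]

theorem letterPerm_val_add_one_eq_iff (hm : 1 ≤ m) (w : List Bool) (i : Fin m) :
    (letterPerm m w i).val + 1 = m ↔ (letterPerm m w).symm ⟨m - 1, by omega⟩ = i := by
  rw [Equiv.symm_apply_eq, Fin.ext_iff]
  simp only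
  omega

/-- Each b contributes one letter to every section, each a contributes none. -/
theorem length_wordSection (i : Fin m) (w : List Bool) :
    (wordSection i w).length = w.count true := by
  induction w with
  | nil => rfl
  | cons s w ih => cases s <;> simp [wordSection, ih]

/-- Of the m letters contributed by one b, exactly one is again b, because the first letters are
permuted bijectively. -/
theorem sum_count_wordSection (hm : 1 ≤ m) (w : List Bool) :
    ∑ i : Fin m, (wordSection i w).count true = w.count true := by
  induction w with
  | nil => simp [wordSection]
  | cons s w ih =>
    cases s
    · simpa [wordSection] using ih
    · simp only [wordSection, List.count_cons, Finset.sum_add_distrib, ih]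
      simp [letterPerm_val_add_one_eq_iff hm]

/-- The generator `b` for the constant defining vector. -/
abbrev constB (m : ℕ) : TreeAut m := genB fun _ : Fin (m - 1) => (1 : ZMod m)

theorem constB_cons (hm : 2 ≤ m) (x : Fin m) (z : List (Fin m)) :
    constB m (x :: z) = x :: (if x.val + 1 = m then constB m else genA m) z := by
  split_ifs with h
  · exact genB_cons_last _ x (by omega) z
  · have hx : x.val < m - 1 := by omega
    have : Fact (1 < m) := ⟨hm⟩
    have h1 := genB_cons_of_lt (fun _ : Fin (m - 1) => (1 : ZMod m)) x hx z
    rwa [ZMod.val_one, pow_one] at h1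

theorem wordEval_apply_nil (w : List Bool) : wordEval (genA m) (constB m) w [] = [] := by
  induction w with
  | nil => rfl
  | cons s w ih =>
    cases s
    · rw [wordEval_cons, RelIso.mul_apply, ih, cond_false, genA, rooted_nil]
    · simp [RelIso.mul_apply, ih, genB_nil]

theorem wordEval_apply_cons (hm : 2 ≤ m) (w : List Bool) (x : Fin m) (z : List (Fin m)) :
    wordEval (genA m) (constB m) w (x :: z) =
      letterPerm m w x :: wordEval (genA m) (constB m) (wordSection x w) z := by
  induction w with
  | nil => rfl
  | cons s w ih =>
    cases s
    · rw [wordEval_cons, RelIso.mul_apply, ih, cond_false, letterPerm_cons_false, wordSection]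
      rfl
    · simp only [wordEval_cons, RelIso.mul_apply, ih, cond_true, constB_cons hm,
        letterPerm_cons_true, wordSection]
      split_ifs with h <;> simp [h]

theorem wordEval_eq_one_iff (hm : 2 ≤ m) (w : List Bool) :
    wordEval (genA m) (constB m) w = 1 ↔
      letterPerm m w = 1 ∧ ∀ i : Fin m, wordEval (genA m) (constB m) (wordSection i w) = 1 := by
  constructor
  · intro h
    have h1 : ∀ x z, letterPerm m w x = x ∧
        wordEval (genA m) (constB m) (wordSection x w) z = z := fun x z => by
      have h2 := wordEval_apply_cons hm w x z
      rw [h] at h2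
      simpa using (List.cons.inj h2.symm)
    exact ⟨Equiv.ext fun x => (h1 x []).1, fun i => RelIso.ext fun z => (h1 i z).2⟩
  · rintro ⟨h1, h2⟩
    ext1 u
    rcases u with _ | ⟨x, z⟩
    · rw [wordEval_apply_nil]; rfl
    · rw [wordEval_apply_cons hm, h1, h2]; rfl

theorem genA_pow_card : genA m ^ m = 1 := by
  rw [genA, rooted_pow, finRotate_pow_self]
  ext1 u
  rcases u with _ | ⟨x, z⟩ <;> rfl

theorem constB_pow_apply_cons (hm : 2 ≤ m) (k : ℕ) (x : Fin m) (z : List (Fin m)) :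
    (constB m ^ k) (x :: z) = x :: ((if x.val + 1 = m then constB m else genA m) ^ k) z := by
  induction k with
  | zero => rfl
  | succ k ih => rw [pow_succ', RelIso.mul_apply, ih, constB_cons hm, pow_succ', RelIso.mul_apply]

theorem constB_pow_card (hm : 2 ≤ m) : constB m ^ m = 1 := by
  ext1 u
  induction u with
  | nil =>
    have := wordEval_apply_nil (m := m) (List.replicate m true)
    rw [wordEval_replicate] at this
    exact this
  | cons x z ih =>
    rw [constB_pow_apply_cons hm]
    split_ifs
    · rw [ih]; rfl
    · rw [genA_pow_card]; rfl

/-! ### The crossed homomorphism and its vanishing on relations -/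

/-- The crossed homomorphism on words that vanishes on `a`, has the value `e` on `b`, and for which
both letters act as `T`. -/
def wordCocycle {M : Type*} [AddCommGroup M] (T : Module.End ℤ M) (e : M) : List Bool → M
  | [] => 0
  | s :: w => cond s e 0 + T (wordCocycle T e w)

section wordCocycle

variable {M : Type*} [AddCommGroup M] {T : Module.End ℤ M} {e : M}

theorem wordCocycle_of_count_eq_zero {w : List Bool} (hw : w.count true = 0) :
    wordCocycle T e w = 0 := by
  induction w with
  | nil => rfl
  | cons s w ih =>
    cases s
    · simp only [List.count_cons] at hw
      simp [wordCocycle, ih (by simpa using hw)]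
    · simp at hw

theorem wordCocycle_replicate_true (k : ℕ) :
    wordCocycle T e (List.replicate k true) = ∑ i ∈ Finset.range k, (T ^ i) e := by
  induction k with
  | zero => rfl
  | succ k ih =>
    rw [List.replicate_succ, wordCocycle, ih, Finset.sum_range_succ', map_sum, add_comm]
    simp [pow_succ']

theorem sum_range_pow_apply_eq_zero (h0 : ∑ i ∈ Finset.range m, (T ^ i) e = 0) (hT : T ^ m = 1)
    {k : ℕ} (hk : m ∣ k) : ∑ i ∈ Finset.range k, (T ^ i) e = 0 := by
  obtain ⟨q, rfl⟩ := hk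
  induction q with
  | zero => simp
  | succ q ih =>
    rw [Nat.mul_succ, Finset.sum_range_add, ih, zero_add]
    simpa [pow_add, pow_mul, hT] using h0

/-- Prefixing either letter applies T to the old terms: a does so by rotating the exponents, b by
lengthening every section. -/
theorem wordCocycle_eq_sum (hm : 1 ≤ m) (hT : T ^ m = 1) (w : List Bool) :
    wordCocycle T e w = ∑ i : Fin m,
      (T ^ ((letterPerm m w i).val + 1)) (wordCocycle T e (wordSection i w)) := by
  induction w with
  | nil => simp [wordCocycle, wordSection]
  | cons s w ih =>
    cases s
    · rw [wordCocycle, ih, cond_false, zero_add, map_sum]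
      refine Finset.sum_congr rfl fun i _ => ?_
      rw [letterPerm_cons_false, wordSection, Equiv.Perm.mul_apply, finRotate_val,
        ← Module.End.mul_apply, ← pow_succ']
      split_ifs with h
      -- The last letter wraps around to the first: exponent m + 1 against 1.
      · rw [h, pow_succ, hT]; simp
      · rfl
    · have h1 : ∀ i : Fin m, (T ^ ((letterPerm m (true :: w) i).val + 1))
          (wordCocycle T e (wordSection i (true :: w))) =
          (if (letterPerm m w).symm ⟨m - 1, by omega⟩ = i then e else 0) +
          T ((T ^ ((letterPerm m w i).val + 1)) (wordCocycle T e (wordSection i w))) := fun i => by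
        rw [letterPerm_cons_true, wordSection, wordCocycle, map_add, ← Module.End.mul_apply,
          ← pow_succ, pow_succ' T (_ + 1), Module.End.mul_apply]
        simp only [← letterPerm_val_add_one_eq_iff hm w i]
        -- The new b lies in the section with exponent m, so it contributes T^m e = e; the new a's
        -- contribute 0.
        split_ifs with h2 <;> simp [h2, hT]
      rw [Finset.sum_congr rfl fun i _ => h1 i, Finset.sum_add_distrib, ← map_sum, ← ih]
      simp [wordCocycle]

/-- A word that is trivial in the group has length divisible by `m`, and the crossed homomorphism
vanishes on it. -/
theorem dvd_length_and_wordCocycle_eq_zero (hm : 2 ≤ m) (hT : T ^ m = 1)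
    (h0 : ∑ i ∈ Finset.range m, (T ^ i) e = 0) (w : List Bool)
    (hw : wordEval (genA m) (constB m) w = 1) : m ∣ w.length ∧ wordCocycle T e w = 0 := by
  induction hl : w.count true using Nat.strong_induction_on generalizing w with
  | _ l ih =>
    obtain ⟨hperm, hsec⟩ := (wordEval_eq_one_iff hm w).1 hw
    have hfalse : m ∣ w.count false :=
      dvd_of_finRotate_pow_eq _ ⟨0, by omega⟩ (by rw [← letterPerm, hperm]; rfl)
    have hlen : w.length = w.count false + l := by
      rw [← hl, ← List.count_false_add_count_true]
    -- If this fails, one section contains all `l` letters b; the case `l = 0` falls there too.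
    by_cases hlt : ∀ i : Fin m, (wordSection i w).count true < l
    · have h1 := fun i => ih _ (hlt i) (wordSection i w) (hsec i) rfl
      refine ⟨?_, ?_⟩
      · have h2 := (h1 ⟨0, by omega⟩).1
        rw [length_wordSection, hl] at h2
        exact hlen ▸ dvd_add hfalse h2
      · rw [wordCocycle_eq_sum (by omega) hT]
        exact Finset.sum_eq_zero fun i _ => by rw [(h1 i).2, map_zero]
    · push Not at hlt
      obtain ⟨i, hi⟩ := hlt
      have hsum := sum_count_wordSection (m := m) (by omega) w
      rw [← Finset.add_sum_erase _ _ (Finset.mem_univ i), hl] at hsum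
      have hz : ∀ j, j ≠ i → (wordSection j w).count true = 0 := fun j hj => by
        have := Finset.single_le_sum (f := fun j : Fin m => (wordSection j w).count true)
          (fun _ _ => Nat.zero_le _) (Finset.mem_erase.2 ⟨hj, Finset.mem_univ j⟩)
        omega
      have : Nontrivial (Fin m) := Fin.nontrivial_iff_two_le.2 hm
      obtain ⟨j, hj⟩ := exists_ne i
      have hjl : wordSection j w = List.replicate l false := by
        rw [List.eq_replicate_iff, length_wordSection, hl]
        refine ⟨rfl, fun s hs => ?_⟩
        cases s
        · rfl
        · exact absurd hs (List.count_eq_zero.1 (hz j hj))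
      -- Another section is a^l, and its triviality bounds the order.
      have hml : m ∣ l := by
        have h1 := hsec j
        rw [hjl, wordEval_replicate, cond_false, genA, rooted_pow] at h1
        have h2 := DFunLike.congr_fun h1 [j]
        exact dvd_of_finRotate_pow_eq l j (List.cons.inj h2).1
      have hil : wordSection i w = List.replicate l true := by
        have h1 : (wordSection i w).length = l := by rw [length_wordSection, hl]
        rw [List.eq_replicate_iff]
        refine ⟨h1, fun s hs => ?_⟩
        have h2 := List.count_eq_length.1
          (le_antisymm List.count_le_length (h1 ▸ hi) :
            (wordSection i w).count true = (wordSection i w).length) s hs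
        exact h2.symm
      refine ⟨hlen ▸ dvd_add hfalse hml, ?_⟩
      rw [wordCocycle_eq_sum (by omega) hT]
      refine Finset.sum_eq_zero fun k _ => ?_
      rcases eq_or_ne k i with rfl | hk
      · rw [hil, wordCocycle_replicate_true, sum_range_pow_apply_eq_zero h0 hT hml, map_zero]
      · rw [wordCocycle_of_count_eq_zero (hz k hk), map_zero]

end wordCocycle

/-! ### The lattice and its companion action -/

/-- The companion matrix of `1 + X + ⋯ + X ^ (m - 1)`, acting on row vectors. -/
noncomputable def companionEnd (m : ℕ) : Module.End ℤ (Fin (m - 1) → ℤ) :=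
  (companion (m - 1) (∑ i ∈ Finset.range m, Polynomial.X ^ i)).vecMulLinear

theorem companionEnd_apply (v : Fin (m - 1) → ℤ) : companionEnd m v =
    Matrix.vecMul v (companion (m - 1) (∑ i ∈ Finset.range m, Polynomial.X ^ i)) := rfl

/-- The first vector of the canonical basis of `ℤ ^ (m - 1)`. -/
def firstVec (hm : 2 ≤ m) : Fin (m - 1) → ℤ := Pi.single ⟨0, by omega⟩ 1

theorem companionEnd_single (i : Fin (m - 1)) (hi : i.val + 1 < m - 1) :
    companionEnd m (Pi.single i 1) = Pi.single ⟨i.val + 1, hi⟩ 1 := by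
  rw [companionEnd_apply, Matrix.single_one_vecMul]
  ext j
  simp only [companion, Matrix.row, Matrix.of_apply, Pi.single_apply, Fin.ext_iff]
  rw [if_neg (by omega)]

theorem companionEnd_single_last (i : Fin (m - 1)) (hi : i.val + 1 = m - 1) :
    companionEnd m (Pi.single i 1) = -∑ j, Pi.single j 1 := by
  rw [companionEnd_apply, Matrix.single_one_vecMul]
  ext j
  have hj : j.val < m := by omega
  simp [companion, hi, Polynomial.coeff_X_pow, Finset.sum_apply, Pi.single_apply, hj]

theorem companionEnd_pow_firstVec (hm : 2 ≤ m) (i : Fin (m - 1)) :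
    (companionEnd m ^ i.val) (firstVec hm) = Pi.single i 1 := by
  obtain ⟨k, hk⟩ := i
  induction k with
  | zero => rfl
  | succ k ih =>
    rw [pow_succ', Module.End.mul_apply, ih (by omega)]
    exact companionEnd_single _ hk

theorem sum_companionEnd_pow_firstVec (hm : 2 ≤ m) :
    ∑ i ∈ Finset.range m, (companionEnd m ^ i) (firstVec hm) = 0 := by
  have h1 : ∑ i ∈ Finset.range (m - 1), (companionEnd m ^ i) (firstVec hm) =
      ∑ j : Fin (m - 1), Pi.single j 1 := by
    rw [← Fin.sum_univ_eq_sum_range fun i => (companionEnd m ^ i) (firstVec hm)]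
    exact Finset.sum_congr rfl fun i _ => companionEnd_pow_firstVec hm i
  have h2 : (companionEnd m ^ (m - 1)) (firstVec hm) = -∑ j : Fin (m - 1), Pi.single j 1 := by
    rw [← companionEnd_single_last ⟨m - 2, by omega⟩ (by simp only; omega),
      ← companionEnd_pow_firstVec hm, ← Module.End.mul_apply, ← pow_succ']
    congr 2
    simp only
    omega
  obtain ⟨d, rfl⟩ : ∃ d, m = d + 1 := ⟨m - 1, by omega⟩
  rw [Finset.sum_range_succ]
  simp only [Nat.add_sub_cancel] at h1 h2
  rw [h1, h2, add_neg_cancel]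

/-- The sum and its image under T both vanish, and they differ by T^m e - e. -/
theorem pow_apply_eq_of_sum_eq_zero {M : Type*} [AddCommGroup M] {T : Module.End ℤ M} {e : M}
    (h0 : ∑ i ∈ Finset.range m, (T ^ i) e = 0) : (T ^ m) e = e := by
  have h1 := Finset.sum_range_succ (fun i => (T ^ i) e) m
  rw [Finset.sum_range_succ', h0, zero_add] at h1
  rw [← h1, pow_zero, Module.End.one_apply, add_eq_right]
  simpa [pow_succ', ← map_sum] using congrArg T h0

theorem companionEnd_pow_card (hm : 2 ≤ m) : companionEnd m ^ m = 1 := by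
  refine (Pi.basisFun ℤ (Fin (m - 1))).ext fun i => ?_
  rw [Pi.basisFun_apply, ← companionEnd_pow_firstVec hm, ← Module.End.mul_apply, ← pow_add,
    add_comm, pow_add, Module.End.mul_apply,
    pow_apply_eq_of_sum_eq_zero (sum_companionEnd_pow_firstVec hm), Module.End.one_apply]

/-- The lattice `ℤ ^ (m - 1)` with the companion action is generated by its first basis vector `e`
subject to `e + T e + ⋯ + T ^ (m - 1) e = 0`. -/
theorem exists_linearMap_of_sum_eq_zero (hm : 2 ≤ m) {B : Type*} [AddCommGroup B]
    (A : Module.End ℤ B) (y : B) (h0 : ∑ i ∈ Finset.range m, (A ^ i) y = 0) :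
    ∃ F : (Fin (m - 1) → ℤ) →ₗ[ℤ] B, F (firstVec hm) = y ∧
      ∀ v, F (companionEnd m v) = A (F v) := by
  let F := (Pi.basisFun ℤ (Fin (m - 1))).constr ℤ fun i => (A ^ i.val) y
  have hF : ∀ i, F (Pi.single i 1) = (A ^ i.val) y := fun i => by
    rw [← Pi.basisFun_apply ℤ, Module.Basis.constr_basis]
  refine ⟨F, hF _, fun v => ?_⟩
  have hcomp : F ∘ₗ companionEnd m = A ∘ₗ F := by
    refine (Pi.basisFun ℤ (Fin (m - 1))).ext fun i => ?_
    rw [Pi.basisFun_apply, LinearMap.comp_apply, LinearMap.comp_apply, hF]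
    by_cases hi : i.val + 1 < m - 1
    · rw [companionEnd_single i hi, hF, pow_succ', Module.End.mul_apply]
    · have hi' : i.val + 1 = m - 1 := by omega
      rw [companionEnd_single_last i hi', map_neg, map_sum, ← Module.End.mul_apply, ← pow_succ',
        hi', neg_eq_iff_add_eq_zero, Finset.sum_congr rfl fun j _ => hF j,
        Fin.sum_univ_eq_sum_range fun j => (A ^ j) y, ← Finset.sum_range_succ,
        Nat.sub_add_cancel (by omega), h0]
  exact LinearMap.congr_fun hcomp v

/-- The automorphism of the lattice given by the companion matrix. -/
noncomputable def companionAut (hm : 2 ≤ m) : MulAut (Multiplicative (Fin (m - 1) → ℤ)) :=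
  AddEquiv.toMultiplicative
    { toFun := companionEnd m
      invFun := ⇑(companionEnd m ^ (m - 1))
      left_inv := fun v => by
        rw [← Module.End.mul_apply, ← pow_succ, Nat.sub_add_cancel (by omega),
          companionEnd_pow_card hm, Module.End.one_apply]
      right_inv := fun v => by
        rw [← Module.End.mul_apply, ← pow_succ', Nat.sub_add_cancel (by omega),
          companionEnd_pow_card hm, Module.End.one_apply]
      map_add' := map_add _ }

theorem companionAut_apply (hm : 2 ≤ m) (v : Fin (m - 1) → ℤ) :
    companionAut hm (Multiplicative.ofAdd v) = Multiplicative.ofAdd (companionEnd m v) := rfl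

theorem companionAut_pow_card (hm : 2 ≤ m) : companionAut hm ^ m = 1 := by
  have h : ∀ (k : ℕ) (v : Fin (m - 1) → ℤ), (companionAut hm ^ k) (Multiplicative.ofAdd v) =
      Multiplicative.ofAdd ((companionEnd m ^ k) v) := fun k v => by
    induction k with
    | zero => rfl
    | succ k ih =>
      rw [pow_succ', MulAut.mul_apply, ih, companionAut_apply, pow_succ', Module.End.mul_apply]
  ext1 v
  exact (h m v.toAdd).trans (by rw [companionEnd_pow_card hm]; rfl)

/-- The action of the cyclic group of order `m` on the lattice through the companion matrix. -/
noncomputable def companionAction (hm : 2 ≤ m) :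
    Multiplicative (ZMod m) →* MulAut (Multiplicative (Fin (m - 1) → ℤ)) :=
  AddMonoidHom.toMultiplicativeLeft (ZMod.lift m
    ⟨zmultiplesHom _ (Additive.ofMul (companionAut hm)), by
      rw [zmultiplesHom_apply, natCast_zsmul, ← ofMul_pow, companionAut_pow_card hm, ofMul_one]⟩)

theorem companionAction_one (hm : 2 ≤ m) :
    companionAction hm (Multiplicative.ofAdd 1) = companionAut hm := by
  have h := ZMod.lift_coe m (⟨zmultiplesHom _ (Additive.ofMul (companionAut hm)), by
      rw [zmultiplesHom_apply, natCast_zsmul, ← ofMul_pow, companionAut_pow_card hm, ofMul_one]⟩ :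
      { f : ℤ →+ Additive (MulAut (Multiplicative (Fin (m - 1) → ℤ))) // f m = 0 }) 1
  rw [Int.cast_one] at h
  exact h.trans (one_zsmul (Additive.ofMul (companionAut hm)))

theorem companionAction_one_apply (hm : 2 ≤ m) (v : Fin (m - 1) → ℤ) :
    companionAction hm (Multiplicative.ofAdd 1) (Multiplicative.ofAdd v) =
      Multiplicative.ofAdd (companionEnd m v) := by
  rw [companionAction_one, companionAut_apply]

/-! ### The homomorphism to the semidirect product -/

/-- The semidirect product of the lattice by the cyclic group of order `m`. -/
abbrev LatticeProd (hm : 2 ≤ m) : Type :=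
  Multiplicative (Fin (m - 1) → ℤ) ⋊[companionAction hm] Multiplicative (ZMod m)

/-- The image of `a` in the semidirect product. -/
def prodA (hm : 2 ≤ m) : LatticeProd hm := ⟨1, Multiplicative.ofAdd 1⟩

/-- The image of `b` in the semidirect product. -/
def prodB (hm : 2 ≤ m) : LatticeProd hm :=
  ⟨Multiplicative.ofAdd (firstVec hm), Multiplicative.ofAdd 1⟩

/-- Both generators have the same cyclic component, so each acts on the lattice as T. -/
theorem wordEval_prod (hm : 2 ≤ m) (w : List Bool) : wordEval (prodA hm) (prodB hm) w =
    ⟨Multiplicative.ofAdd (wordCocycle (companionEnd m) (firstVec hm) w),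
      Multiplicative.ofAdd (w.length : ZMod m)⟩ := by
  induction w with
  | nil => exact SemidirectProduct.ext rfl (by simp)
  | cons s w ih =>
    rw [wordEval_cons, ih]
    cases s
    · refine SemidirectProduct.ext ?_ ?_
      · simp [prodA, SemidirectProduct.mul_left, companionAction_one_apply, wordCocycle]
      · simp [prodA, SemidirectProduct.mul_right, ← ofAdd_add, add_comm]
    · refine SemidirectProduct.ext ?_ ?_
      · simp [prodB, SemidirectProduct.mul_left, companionAction_one_apply, wordCocycle]
      · simp [prodB, SemidirectProduct.mul_right, ← ofAdd_add, add_comm]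

/-- `a` as an element of the GGS-group with constant defining vector. -/
abbrev groupA (m : ℕ) : constGroup m := ggsA _

/-- `b` as an element of the GGS-group with constant defining vector. -/
abbrev groupB (m : ℕ) : constGroup m := ggsB _

theorem coe_wordEval_group (w : List Bool) :
    ((wordEval (groupA m) (groupB m) w : constGroup m) : TreeAut m) =
      wordEval (genA m) (constB m) w :=
  map_wordEval _ _ (Subgroup.subtype _) w

theorem groupA_pow_card : groupA m ^ m = 1 := Subtype.ext genA_pow_card

theorem groupB_pow_card (hm : 2 ≤ m) : groupB m ^ m = 1 := Subtype.ext (constB_pow_card hm)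

theorem exists_wordEval_group (hm : 2 ≤ m) (g : constGroup m) :
    ∃ w, wordEval (groupA m) (groupB m) w = g := by
  obtain ⟨w, hw⟩ := exists_wordEval_of_mem_closure (by omega) genA_pow_card
    (constB_pow_card hm) g.2
  exact ⟨w, Subtype.ext ((coe_wordEval_group w).trans hw)⟩

theorem exists_hom_latticeProd (hm : 2 ≤ m) : ∃ f : constGroup m →* LatticeProd hm,
    ∀ w, f (wordEval (groupA m) (groupB m) w) = wordEval (prodA hm) (prodB hm) w := by
  refine exists_hom_of_wordEval (exists_wordEval_group hm) fun w hw => ?_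
  obtain ⟨h1, h2⟩ := dvd_length_and_wordCocycle_eq_zero hm (companionEnd_pow_card hm)
    (sum_companionEnd_pow_firstVec hm) w (by rw [← coe_wordEval_group, hw]; rfl)
  rw [wordEval_prod, h2, (ZMod.natCast_eq_zero_iff _ _).2 h1]
  rfl

/-! ### The abelianization of K and the kernel -/

/-- The generator `b a⁻¹` of `K` as a normal subgroup. -/
def genK (m : ℕ) : subgroupK m :=
  ⟨groupB m * (groupA m)⁻¹, Subgroup.subset_normalClosure rfl⟩

/-- Conjugation by `a` on the abelianization of `K`. -/
def conjAb (m : ℕ) : Module.End ℤ (Additive (Abelianization (subgroupK m))) :=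
  (MonoidHom.toAdditive
    (Abelianization.map (MulAut.conjNormal (groupA m)).toMonoidHom)).toIntLinearMap

theorem conjAb_of (k : subgroupK m) : conjAb m (Additive.ofMul (Abelianization.of k)) =
    Additive.ofMul (Abelianization.of (MulAut.conjNormal (groupA m) k)) := rfl

/-- Every word is congruent to a power of `a` modulo `K`, and its part in the abelianization of `K`
is computed by the crossed homomorphism. -/
theorem exists_wordEval_eq_mul_pow (w : List Bool) : ∃ k : subgroupK m,
    wordEval (groupA m) (groupB m) w = k * groupA m ^ w.length ∧
    Additive.ofMul (Abelianization.of k) =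
      wordCocycle (conjAb m) (Additive.ofMul (Abelianization.of (genK m))) w := by
  induction w with
  | nil => exact ⟨1, by simp, by simp [wordCocycle]⟩
  | cons s w ih =>
    obtain ⟨k, hk, hc⟩ := ih
    cases s
    · refine ⟨MulAut.conjNormal (groupA m) k, ?_, ?_⟩
      · rw [wordEval_cons, hk, MulAut.conjNormal_apply, List.length_cons, pow_succ', cond_false]
        group
      · rw [← conjAb_of, hc]; simp [wordCocycle]
    · refine ⟨genK m * MulAut.conjNormal (groupA m) k, ?_, ?_⟩
      · rw [wordEval_cons, hk, Subgroup.coe_mul, MulAut.conjNormal_apply, List.length_cons,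
          pow_succ', cond_true, genK]
        group
      · rw [map_mul, ofMul_mul, ← conjAb_of, hc]; simp [wordCocycle]

/-- The sum is the cocycle of the word b^m, whose K-part is trivial because a^m = b^m = 1. -/
theorem sum_conjAb_pow_genK (hm : 2 ≤ m) : ∑ i ∈ Finset.range m,
    (conjAb m ^ i) (Additive.ofMul (Abelianization.of (genK m))) = 0 := by
  obtain ⟨k, hk, hc⟩ := exists_wordEval_eq_mul_pow (m := m) (List.replicate m true)
  rw [wordEval_replicate, cond_true, groupB_pow_card hm, List.length_replicate, groupA_pow_card,
    mul_one] at hk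
  rw [wordCocycle_replicate_true] at hc
  rw [← hc, show k = 1 from Subtype.ext hk.symm, map_one, ofMul_one]

theorem map_wordCocycle {M B : Type*} [AddCommGroup M] [AddCommGroup B] {T : Module.End ℤ M}
    {A : Module.End ℤ B} (F : M →ₗ[ℤ] B) (h : ∀ v, F (T v) = A (F v)) (e : M) (w : List Bool) :
    F (wordCocycle T e w) = wordCocycle A (F e) w := by
  induction w with
  | nil => simp [wordCocycle]
  | cons s w ih => cases s <;> simp [wordCocycle, h, ih]

theorem hom_groupA (hm : 2 ≤ m) {f : constGroup m →* LatticeProd hm}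
    (hf : ∀ w, f (wordEval (groupA m) (groupB m) w) = wordEval (prodA hm) (prodB hm) w) :
    f (groupA m) = prodA hm := by simpa using hf [false]

theorem hom_groupB (hm : 2 ≤ m) {f : constGroup m →* LatticeProd hm}
    (hf : ∀ w, f (wordEval (groupA m) (groupB m) w) = wordEval (prodA hm) (prodB hm) w) :
    f (groupB m) = prodB hm := by simpa using hf [true]

theorem ker_eq_commutator (hm : 2 ≤ m) {f : constGroup m →* LatticeProd hm}
    (hf : ∀ w, f (wordEval (groupA m) (groupB m) w) = wordEval (prodA hm) (prodB hm) w) :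
    f.ker = ⁅subgroupK m, subgroupK m⁆ := by
  apply le_antisymm
  · intro g hg
    obtain ⟨w, rfl⟩ := exists_wordEval_group hm g
    rw [MonoidHom.mem_ker, hf, wordEval_prod] at hg
    have hc : wordCocycle (companionEnd m) (firstVec hm) w = 0 :=
      congrArg SemidirectProduct.left hg
    have hl : (w.length : ZMod m) = 0 := congrArg SemidirectProduct.right hg
    -- `F` carries the lattice cocycle of `w` to its cocycle in K/K', so the latter vanishes as
    -- well.
    obtain ⟨F, hFe, hF⟩ := exists_linearMap_of_sum_eq_zero hm (conjAb m) _
      (sum_conjAb_pow_genK hm)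
    obtain ⟨k, hk, hkc⟩ := exists_wordEval_eq_mul_pow (m := m) w
    rw [← hFe, ← map_wordCocycle F hF, hc, map_zero] at hkc
    obtain ⟨q, hq⟩ := (ZMod.natCast_eq_zero_iff _ _).1 hl
    rw [hq, pow_mul, groupA_pow_card, one_pow, mul_one] at hk
    rw [hk, ← Subgroup.map_subtype_commutator]
    refine Subgroup.mem_map_of_mem _ ?_
    rw [← Abelianization.ker_of]
    exact hkc
  -- K lands in the abelian lattice, since a and b have equal cyclic components.
  · have hK : subgroupK m ≤ (SemidirectProduct.rightHom.comp f).ker := by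
      refine Subgroup.normalClosure_le_normal ?_
      rintro _ rfl
      change SemidirectProduct.rightHom (f (groupB m * (groupA m)⁻¹)) = 1
      rw [map_mul, map_inv, hom_groupA hm hf, hom_groupB hm hf, map_mul, map_inv]
      exact mul_inv_cancel _
    rw [Subgroup.commutator_le]
    intro g hg g' hg'
    rw [MonoidHom.mem_ker, map_commutatorElement, commutatorElement_eq_one_iff_mul_comm]
    have h1 : (f g).right = 1 := hK hg
    have h2 : (f g').right = 1 := hK hg'
    refine SemidirectProduct.ext ?_ ?_
    · simp [SemidirectProduct.mul_left, h1, h2, mul_comm]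
    · simp [SemidirectProduct.mul_right, h1, h2]

/-! ### Surjectivity and the final isomorphism -/

theorem hom_latticeProd_surjective (hm : 2 ≤ m) {f : constGroup m →* LatticeProd hm}
    (hf : ∀ w, f (wordEval (groupA m) (groupB m) w) = wordEval (prodA hm) (prodB hm) w) :
    Function.Surjective f := by
  have hinr : ∀ k, SemidirectProduct.inr k ∈ f.range := by
    intro k
    have : NeZero m := ⟨by omega⟩
    have h1 : k = Multiplicative.ofAdd (1 : ZMod m) ^ k.toAdd.val := by
      rw [← ofAdd_nsmul, nsmul_one, ZMod.natCast_zmod_val, ofAdd_toAdd]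
    rw [h1, map_pow]
    exact pow_mem (MonoidHom.mem_range.2 ⟨_, hom_groupA hm hf⟩) _
  -- The image contains x, and conjugation by x is the companion action; the lattice part is thus
  -- generated from e.
  have hT : ∀ v, SemidirectProduct.inl (Multiplicative.ofAdd v) ∈ f.range →
      SemidirectProduct.inl (Multiplicative.ofAdd (companionEnd m v)) ∈ f.range := by
    intro v hv
    rw [← companionAction_one_apply hm, SemidirectProduct.inl_aut]
    exact mul_mem (mul_mem (hinr _) hv) (hinr _)
  have hfirst : SemidirectProduct.inl (Multiplicative.ofAdd (firstVec hm)) ∈ f.range := by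
    have h1 : prodB hm = SemidirectProduct.inl (Multiplicative.ofAdd (firstVec hm)) *
        SemidirectProduct.inr (Multiplicative.ofAdd 1) := SemidirectProduct.mk_eq_inl_mul_inr _ _
    rw [eq_mul_inv_iff_mul_eq.2 h1.symm]
    exact mul_mem (MonoidHom.mem_range.2 ⟨_, hom_groupB hm hf⟩) (inv_mem (hinr _))
  have hbasis : ∀ i : Fin (m - 1),
      SemidirectProduct.inl (Multiplicative.ofAdd (Pi.single i 1)) ∈ f.range := by
    intro i
    rw [← companionEnd_pow_firstVec hm]
    induction i.val with
    | zero => exact hfirst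
    | succ k ih => rw [pow_succ', Module.End.mul_apply]; exact hT _ ih
  intro h
  change h ∈ f.range
  rw [← SemidirectProduct.inl_left_mul_inr_right h]
  refine mul_mem ?_ (hinr _)
  rw [← ofAdd_toAdd h.left, pi_eq_sum_univ' h.left.toAdd, ofAdd_sum,
    ← Subgroup.mem_comap]
  refine Subgroup.prod_mem _ fun i _ => ?_
  rw [ofAdd_zsmul]
  exact zpow_mem (Subgroup.mem_comap.2 (hbasis i)) _

end GGS

theorem theorem3p7 (p n : ℕ) (hp : p.Prime) (hn : 1 ≤ n) :
    (∃ φ : Multiplicative (ZMod (p ^ n)) →* MulAut (Multiplicative (Fin (p ^ n - 1) → ℤ)),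
      (∀ v : Fin (p ^ n - 1) → ℤ,
        φ (Multiplicative.ofAdd 1) (Multiplicative.ofAdd v) =
          Multiplicative.ofAdd (Matrix.vecMul v
            (GGS.companion (p ^ n - 1) (∑ i ∈ Finset.range (p ^ n), Polynomial.X ^ i)))) ∧
      Nonempty ((GGS.constGroup (p ^ n) ⧸ ⁅GGS.subgroupK (p ^ n), GGS.subgroupK (p ^ n)⁆) ≃*
        Multiplicative (Fin (p ^ n - 1) → ℤ) ⋊[φ] Multiplicative (ZMod (p ^ n)))) ∧
    Infinite (GGS.constGroup (p ^ n) ⧸ ⁅GGS.subgroupK (p ^ n), GGS.subgroupK (p ^ n)⁆) := by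
  have hm : 2 ≤ p ^ n := hp.two_le.trans (Nat.le_self_pow (by omega) p)
  obtain ⟨f, hf⟩ := GGS.exists_hom_latticeProd hm
  let e := (QuotientGroup.quotientMulEquivOfEq (GGS.ker_eq_commutator hm hf).symm).trans
    (QuotientGroup.quotientKerEquivOfSurjective f (GGS.hom_latticeProd_surjective hm hf))
  refine ⟨⟨GGS.companionAction hm, GGS.companionAction_one_apply hm, ⟨e⟩⟩, ?_⟩
  have : Nonempty (Fin (p ^ n - 1)) := ⟨⟨0, by omega⟩⟩
  have : Infinite (Multiplicative (Fin (p ^ n - 1) → ℤ)) :=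
    inferInstanceAs (Infinite (Fin (p ^ n - 1) → ℤ))
  have : Infinite (GGS.LatticeProd hm) :=
    Infinite.of_injective _ (SemidirectProduct.inl_injective (φ := GGS.companionAction hm))
  exact Infinite.of_injective _ e.symm.injective
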